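/- Let $A$ be a real $n\times n$ matrix. For an eigenvalue $l$ of $A$ let $\mathrm{algm}(l)$ be its algebraic multiplicity (its multiplicity as a root of the characteristic polynomial of $A$) and $\mathrm{geom}(l)$ its geometric multiplicity (the dimension of $\ker(A-lI)$, over $\mathbb{R}$ for real $l$ and over $\mathbb{C}$ for non-real $l$). Suppose that (a) $\lambda\le 0$ for every real eigenvalue $\lambda$ of $A$; (b) $\lambda<0$ for every real eigenvalue $\lambda$ of $A$ with $\mathrm{geom}(\lambda)<\mathrm{algm}(\lambda)$; (c) $a+|b|\le 0$ for every non-real complex eigenvalue $a+\iota b$ of $A$ ($a,b\in\mathbb{R}$, $b\ne0$); (d) $a+|b|<0$ for every non-real complex eigenvalue $a+\iota b$ of $A$ with $\mathrm{geom}(a+\iota b)<\mathrm{algm}(a+\iota b)$. Then the linear system $\frac{dx}{dt}=Ax$ has a bounded $2n$-LI ($2n$ linear invariant): there is an invertible real $n\times n$ matrix $F$ such that the region $\{x\in\mathbb{R}^n : \|Fx\|_\infty\le 1\}$ is invariant, i.e. every trajectory $x:[0,\infty)\to\mathbb{R}^n$ of the system with $\|Fx(0)\|_\infty\le 1$ satisfies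 $\|Fx(t)\|_\infty\le1$ for all $t\ge0$. -/

import Mathlib

/-- `x` is a trajectory on `[0, ∞)` of the linear system `dx/dt = A x`
(at `t = 0` the derivative is one-sided). -/
def IsTrajectory {n : ℕ} (A : Matrix (Fin n) (Fin n) ℝ) (x : ℝ → Fin n → ℝ) : Prop :=
  ∀ t : ℝ, 0 ≤ t → HasDerivWithinAt x (A.mulVec (x t)) (Set.Ici 0) t

/-- `S` is (positively) invariant for `dx/dt = A x`: a trajectory that starts in `S` is in `S` at
all times `t ≥ 0`. -/
def IsInvariantSet {n : ℕ} (A : Matrix (Fin n) (Fin n) ℝ) (S : Set (Fin n → ℝ)) : Prop :=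
  ∀ x : ℝ → Fin n → ℝ, IsTrajectory A x → x 0 ∈ S → ∀ t : ℝ, 0 ≤ t → x t ∈ S

/-- For an `s × n` matrix `F`, the region `‖F x‖_∞ ≤ 1`, a conjunction of `2 s` linear
inequalities `-1 ≤ (F x)_i ≤ 1`. The norm on `Fin s → ℝ` is the maximum norm. -/
def symPolyhedron {s n : ℕ} (F : Matrix (Fin s) (Fin n) ℝ) : Set (Fin n → ℝ) :=
  {x | ‖F.mulVec x‖ ≤ 1}

/-- For an `s × n` matrix `F`, the region `‖F x‖_∞ ≤ 1` is a `2s`-linear invariant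
(`2s`-LI) of `dx/dt = A x`. -/
def IsLinearInvariant {s n : ℕ} (A : Matrix (Fin n) (Fin n) ℝ) (F : Matrix (Fin s) (Fin n) ℝ) :
    Prop :=
  IsInvariantSet A (symPolyhedron F)

/-- `l` is an eigenvalue of the matrix `A` over the field `K`. -/
def IsMatrixEigenvalue {K : Type*} [Field K] {n : ℕ} (A : Matrix (Fin n) (Fin n) K) (l : K) :
    Prop :=
  Module.End.HasEigenvalue (Matrix.toLin' A) l

/-- Algebraic multiplicity: the multiplicity of `l` as a root of the characteristic polynomial. -/
noncomputable def algm {K : Type*} [Field K] {n : ℕ} (A : Matrix (Fin n) (Fin n) K) (l : K) : ℕ :=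
  A.charpoly.rootMultiplicity l

/-- Geometric multiplicity: the dimension of the eigenspace of `l`. -/
noncomputable def geom {K : Type*} [Field K] {n : ℕ} (A : Matrix (Fin n) (Fin n) K) (l : K) : ℕ :=
  Module.finrank K (Module.End.eigenspace (Matrix.toLin' A) l)

/-- A real matrix, regarded as a complex matrix. -/
noncomputable def complexify {n : ℕ} (A : Matrix (Fin n) (Fin n) ℝ) : Matrix (Fin n) (Fin n) ℂ :=
  A.map (algebraMap ℝ ℂ)

/-! If `F * A = M * F` and every row of `M` satisfies `M i i + ∑_{j ≠ i} |M i j| ≤ 0`, then `‖F x‖`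
never grows (`isLinearInvariant_of_rowLogNorm_nonpos`). The rows of such an `F` form a basis in
which the transpose of `A` acts by `M`, so the task is to find a good basis for an endomorphism `S`.
An eigenvalue `a + b i` contributes a block with rows `(a, b)` and `(-b, a)`, whose row bound is `a
+ |b|`. Stacking blocks triangularly creates couplings; rescaling makes them arbitrarily small, so
they cost nothing when `a + |b| < 0` throughout (`exists_neg_hasRowBound`). Critical eigenvalues,
with `a + |b| = 0`, leave no slack, but being semisimple they split off as direct summands
(`hasRowBound_zero`). -/

/-! ### Real irreducible factors and polynomials in an endomorphism -/

/-- The real factor of the characteristic polynomial attached to the eigenvalue `a + b i`. -/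
noncomputable def realFactor (a b : ℝ) : Polynomial ℝ :=
  if b = 0 then Polynomial.X - Polynomial.C a
  else (Polynomial.X - Polynomial.C a) ^ 2 + Polynomial.C (b ^ 2)

theorem realFactor_separable (a b : ℝ) : (realFactor a b).Separable := by
  unfold realFactor
  split_ifs with h
  · exact Polynomial.separable_X_sub_C
  · refine ⟨Polynomial.C (1 / b ^ 2), -Polynomial.C (1 / (2 * b ^ 2)) *
      (Polynomial.X - Polynomial.C a), ?_⟩
    have h1 : (Polynomial.C (1 / b ^ 2) : Polynomial ℝ) * Polynomial.C (b ^ 2) = 1 := by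
      rw [← Polynomial.C_mul, one_div, inv_mul_cancel₀ (by positivity), Polynomial.C_1]
    have h2 : (Polynomial.C (1 / (2 * b ^ 2)) : Polynomial ℝ) * 2 = Polynomial.C (1 / b ^ 2) := by
      rw [show (2 : Polynomial ℝ) = Polynomial.C 2 from rfl, ← Polynomial.C_mul]
      congr 1
      field_simp
    simp only [Polynomial.derivative_add, Polynomial.derivative_C, Polynomial.derivative_pow,
      Polynomial.derivative_sub, Polynomial.derivative_X]
    simp only [sub_zero, mul_one, add_zero, Nat.cast_ofNat, map_ofNat, Nat.reduceSub, pow_one]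
    linear_combination h1 - (Polynomial.X - Polynomial.C a) ^ 2 * h2

theorem realFactor_dvd_of_aeval_eq_zero (p : Polynomial ℝ) (z : ℂ)
    (hz : Polynomial.aeval z p = 0) : realFactor z.re z.im ∣ p := by
  unfold realFactor
  split_ifs with h
  · rw [Polynomial.dvd_iff_isRoot]
    have hz' : z = algebraMap ℝ ℂ z.re := Complex.ext (by simp) (by simp [h])
    rw [hz', Polynomial.aeval_algebraMap_apply] at hz
    have := (algebraMap ℝ ℂ).injective (hz.trans (map_zero _).symm)
    simpa using this
  · have := p.quadratic_dvd_of_aeval_eq_zero_im_ne_zero hz h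
    convert this using 1
    rw [Complex.sq_norm, Complex.normSq_apply]
    simp only [map_add, map_mul, map_pow, map_ofNat]
    ring

theorem natDegree_realFactor_pos (a b : ℝ) : 0 < (realFactor a b).natDegree := by
  unfold realFactor
  split_ifs with h
  · simp
  · rw [Polynomial.natDegree_add_C]
    simp

section EndLemmas

variable {V : Type*} [AddCommGroup V] [Module ℝ V]

theorem aeval_restrict_coe (S : Module.End ℝ V) (U : Submodule ℝ V) (hU : ∀ x ∈ U, S x ∈ U)
    (p : Polynomial ℝ) (v : U) :
    ((Polynomial.aeval (S.restrict hU : Module.End ℝ U) p v : U) : V) =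
      Polynomial.aeval S p (v : V) := by
  induction p using Polynomial.induction_on' generalizing v with
  | add p q hp hq => simp [hp, hq]
  | monomial k c =>
    simp only [Polynomial.aeval_monomial, Module.End.mul_apply, Module.algebraMap_end_apply,
      Submodule.coe_smul]
    congr 1
    induction k generalizing v with
    | zero => simp
    | succ k ih => simp [pow_succ, ih]

theorem aeval_mapQ_mk (S : Module.End ℝ V) (U : Submodule ℝ V) (hU : U ≤ U.comap S)
    (p : Polynomial ℝ) (v : V) :
    Polynomial.aeval (U.mapQ U S hU : Module.End ℝ (V ⧸ U)) p (Submodule.Quotient.mk v) =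
      Submodule.Quotient.mk (Polynomial.aeval S p v) := by
  induction p using Polynomial.induction_on' generalizing v with
  | add p q hp hq => simp [hp, hq]
  | monomial k c =>
    simp only [Polynomial.aeval_monomial, Module.End.mul_apply, Module.algebraMap_end_apply,
      Submodule.Quotient.mk_smul]
    congr 1
    induction k generalizing v with
    | zero => simp
    | succ k ih => simp [pow_succ, ih]

/-- The real factor of a complex root of the minimal polynomial divides it. Were this factor
injective at `S`, the cofactor would annihilate `S` with smaller degree. -/
theorem exists_realFactor_apply_eq_zero [FiniteDimensional ℝ V] [Nontrivial V]
    (S : Module.End ℝ V) :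
    ∃ a b : ℝ, ∃ v : V, v ≠ 0 ∧ Polynomial.aeval S (realFactor a b) v = 0 := by
  have hint : IsIntegral ℝ S := Algebra.IsIntegral.isIntegral S
  obtain ⟨z, hz⟩ := IsAlgClosed.exists_aeval_eq_zero ℂ (minpoly ℝ S)
    (Polynomial.degree_pos_of_ne_zero_of_nonunit (minpoly.ne_zero hint)
      (minpoly.not_isUnit ℝ S)).ne'
  obtain ⟨r, hr⟩ := realFactor_dvd_of_aeval_eq_zero _ z hz
  refine ⟨z.re, z.im, ?_⟩
  by_contra! hcon
  have hr0 : r ≠ 0 := by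
    rintro rfl
    exact minpoly.ne_zero hint (by simpa using hr)
  have hf0 : realFactor z.re z.im ≠ 0 := (realFactor_separable _ _).ne_zero
  have hrS : Polynomial.aeval S r = 0 := by
    ext v
    by_contra hv
    refine hcon _ hv ?_
    rw [← Module.End.mul_apply, ← map_mul, ← hr, minpoly.aeval]
    rfl
  have h1 := Polynomial.natDegree_le_of_dvd (minpoly.dvd ℝ S hrS) hr0
  rw [hr, Polynomial.natDegree_mul hf0 hr0] at h1
  have := natDegree_realFactor_pos z.re z.im
  omega

end EndLemmas

/-! ### Bases with bounded logarithmic norm -/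

/-- The contribution `M i i + ∑_{j ≠ i} |M i j|` of the row `i` to the logarithmic maximum norm
of `M`. -/
def rowLogNorm {ι : Type*} [Fintype ι] (M : ι → ι → ℝ) (i : ι) : ℝ :=
  M i i - |M i i| + ∑ j, |M i j|

/-- Some basis expresses `S` by a matrix (with the image of the `i`-th basis vector in the
`i`-th row) of logarithmic maximum norm at most `c`. -/
def HasRowBound {V : Type*} [AddCommGroup V] [Module ℝ V] (S : Module.End ℝ V) (c : ℝ) : Prop :=
  ∃ (ι : Type) (_ : Fintype ι) (b : Module.Basis ι ℝ V) (M : ι → ι → ℝ),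
    (∀ i, S (b i) = ∑ j, M i j • b j) ∧ ∀ i, rowLogNorm M i ≤ c

section RowBound

variable {V : Type*} [AddCommGroup V] [Module ℝ V]

theorem HasRowBound.of_subsingleton [Subsingleton V] (S : Module.End ℝ V) (c : ℝ) :
    HasRowBound S c :=
  ⟨Empty, inferInstance, Module.Basis.empty V, fun i _ => i.elim, fun i => i.elim,
    fun i => i.elim⟩

theorem HasRowBound.of_isCompl {S : Module.End ℝ V} {U W : Submodule ℝ V} (h : IsCompl U W)
    (hU : ∀ x ∈ U, S x ∈ U) (hW : ∀ x ∈ W, S x ∈ W) {c : ℝ}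
    (hSU : HasRowBound (S.restrict hU) c) (hSW : HasRowBound (S.restrict hW) c) :
    HasRowBound S c := by
  obtain ⟨ι, _, b, M, hb, hM⟩ := hSU
  obtain ⟨κ, _, d, N, hd, hN⟩ := hSW
  have hb' : ∀ i, S (b i) = ∑ j, M i j • (b j : V) := fun i => by
    simpa using congrArg (Subtype.val) (hb i)
  have hd' : ∀ i, S (d i) = ∑ j, N i j • (d j : V) := fun i => by
    simpa using congrArg (Subtype.val) (hd i)
  refine ⟨ι ⊕ κ, inferInstance, (b.prod d).map (Submodule.prodEquivOfIsCompl U W h),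
    Sum.elim (fun i => Sum.elim (M i) 0) (fun k => Sum.elim 0 (N k)), ?_, ?_⟩
  · rintro (i | i) <;> simp [hb', hd']
  · rintro (i | i)
    · simpa [rowLogNorm] using hM i
    · simpa [rowLogNorm] using hN i

/-- A lifted basis of the quotient gives a block triangular matrix. Multiplying the basis of `U` by
a large `R` divides the coupling by `R` and keeps the diagonal blocks, so the slack `c' - c` absorbs
it. -/
theorem HasRowBound.of_quotient {S : Module.End ℝ V} {U : Submodule ℝ V}
    (hU : U ≤ U.comap S) {c c' : ℝ} (hc : c < c')
    (hSU : HasRowBound (S.restrict hU) c') (hSQ : HasRowBound (U.mapQ U S hU) c) :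
    HasRowBound S c' := by
  obtain ⟨ι, _, b, M, hb, hM⟩ := hSU
  obtain ⟨κ, _, d, N, hd, hN⟩ := hSQ
  have hb' : ∀ i, S (b i) = ∑ j, M i j • (b j : V) := fun i => by
    simpa using congrArg (Subtype.val) (hb i)
  set e := Module.Basis.sumQuot b d with he
  have hlift : ∀ k, ∃ E : ι → ℝ,
      S (e (Sum.inr k)) = ∑ j, E j • (b j : V) + ∑ j, N k j • e (Sum.inr j) := by
    intro k
    have hmem : S (e (Sum.inr k)) - ∑ j, N k j • e (Sum.inr j) ∈ U := by
      rw [← Submodule.Quotient.mk_eq_zero]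
      have h1 := hd k
      rw [← Module.Basis.sumQuot_inr b d k, Submodule.mapQ_apply] at h1
      rw [Submodule.Quotient.mk_sub, h1, sub_eq_zero]
      simp only [← Submodule.mkQ_apply, map_sum, map_smul]
      simp [he]
    refine ⟨fun j => b.repr ⟨_, hmem⟩ j, ?_⟩
    have h2 := congrArg Subtype.val (b.sum_repr ⟨_, hmem⟩)
    simp only [Submodule.coe_sum, Submodule.coe_smul] at h2
    rw [h2]
    abel
  choose E hE using hlift
  obtain ⟨R, hR, hRE⟩ : ∃ R : ℝ, 0 < R ∧ ∀ k, ∑ j, |E k j| ≤ R * (c' - c) := by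
    refine ⟨(∑ k, ∑ j, |E k j|) / (c' - c) + 1, ?_, fun k => ?_⟩
    · have : 0 ≤ ∑ k, ∑ j, |E k j| := by positivity
      have := div_nonneg this (sub_pos.2 hc).le
      linarith
    · have h1 : ∑ j, |E k j| ≤ ∑ k, ∑ j, |E k j| :=
        Finset.single_le_sum (f := fun k => ∑ j, |E k j|) (fun _ _ => by positivity)
          (Finset.mem_univ k)
      rw [add_mul, div_mul_cancel₀ _ (sub_pos.2 hc).ne']
      linarith
  refine ⟨ι ⊕ κ, inferInstance,
    e.unitsSMul (Sum.elim (fun _ => Units.mk0 R hR.ne') (fun _ => 1)),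
    Sum.elim (fun i => Sum.elim (M i) 0) (fun k => Sum.elim (fun j => E k j / R) (N k)), ?_, ?_⟩
  · rintro (i | i)
    · simp [Module.Basis.unitsSMul_apply, Units.smul_def, he, hb', Finset.smul_sum, smul_comm R]
    · simp [Module.Basis.unitsSMul_apply, Units.smul_def, hE, smul_smul, hR.ne']
      simp [he]
  · rintro (i | i)
    · simpa [rowLogNorm] using hM i
    · have h1 := hN i
      have h2 : ∑ j, |E i j / R| ≤ c' - c := by
        simp only [abs_div, ← Finset.sum_div, abs_of_pos hR]
        rw [div_le_iff₀ hR, mul_comm]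
        exact hRE i
      simp only [rowLogNorm, Fintype.sum_sum_type, Sum.elim_inl,
        Sum.elim_inr] at h1 ⊢
      linarith

theorem exists_invariant_hasRowBound_of_linearIndependent {S : Module.End ℝ V} {ι : Type}
    [Fintype ι] {w : ι → V} (hw : LinearIndependent ℝ w) {M : ι → ι → ℝ}
    (hS : ∀ i, S (w i) = ∑ j, M i j • w j) {c : ℝ} (hM : ∀ i, rowLogNorm M i ≤ c) :
    ∃ hU : Submodule.span ℝ (Set.range w) ≤ (Submodule.span ℝ (Set.range w)).comap S,
      HasRowBound (S.restrict hU) c := by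
  have hU : Submodule.span ℝ (Set.range w) ≤ (Submodule.span ℝ (Set.range w)).comap S := by
    rw [Submodule.span_le]
    rintro _ ⟨i, rfl⟩
    simp only [Submodule.comap_coe, Set.mem_preimage, SetLike.mem_coe, hS]
    exact Submodule.sum_mem _ fun j _ =>
      Submodule.smul_mem _ _ (Submodule.subset_span (Set.mem_range_self j))
  refine ⟨hU, ι, inferInstance, Module.Basis.span hw, M, fun i => Subtype.ext ?_, hM⟩
  simp [Module.Basis.span_apply, hS]

theorem exists_invariant_hasRowBound_of_realFactor {S : Module.End ℝ V} {a b : ℝ} {v : V}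
    (hv : v ≠ 0) (h : Polynomial.aeval S (realFactor a b) v = 0) :
    ∃ U : Submodule ℝ V, U ≠ ⊥ ∧ ∃ hU : U ≤ U.comap S, HasRowBound (S.restrict hU) (a + |b|) := by
  by_cases hb : b = 0
  · subst hb
    have hSv : S v = a • v := by
      simpa [realFactor, sub_eq_zero] using h
    obtain ⟨hU, hU'⟩ := exists_invariant_hasRowBound_of_linearIndependent (S := S)
      (w := fun _ : Unit => v) (M := fun _ _ => a) (c := a + |0|)
      (linearIndependent_unique_iff.2 hv) (by simp [hSv]) (by simp [rowLogNorm])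
    refine ⟨_, ?_, hU, hU'⟩
    intro h0
    exact hv ((Submodule.eq_bot_iff _).1 h0 v (Submodule.subset_span ⟨(), rfl⟩))
  -- The vectors `v`, `u` act as real and imaginary parts of an eigenvector.
  · set u : V := b⁻¹ • (S v - a • v) with hu
    have hSv : S v = a • v + b • u := by
      rw [hu, smul_smul, mul_inv_cancel₀ hb, one_smul]
      abel
    have hSSv : S (S v) = (2 * a) • S v - (a ^ 2 + b ^ 2) • v := by
      simp only [realFactor, if_neg hb, pow_two, map_add, map_mul, map_sub, Polynomial.aeval_X,
        Polynomial.aeval_C, LinearMap.add_apply, Module.End.mul_apply, LinearMap.sub_apply,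
        Module.algebraMap_end_apply, smul_sub, map_smul] at h
      rw [← sub_eq_zero, ← h]
      module
    have hSu : S u = (-b) • v + a • u := by
      apply smul_right_injective V hb
      have h1 : b • u = S v - a • v := by rw [hSv]; abel
      simp only
      rw [← map_smul, smul_add, smul_comm b a u, h1, map_sub, map_smul, hSSv]
      module
    have hli : LinearIndependent ℝ ![v, u] := by
      rw [LinearIndependent.pair_iff]
      intro s t hst
      have h1 : (s * a - t * b) • v + (s * b + t * a) • u = 0 := by
        have := congrArg S hst
        rw [map_add, map_smul, map_smul, hSv, hSu, map_zero] at this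
        rw [← this]
        module
      -- Eliminate `u` between the relation and its image under `S`.
      have h2 : (b * (s ^ 2 + t ^ 2)) • v = 0 := by
        have e : (b * (s ^ 2 + t ^ 2)) • v = (s * b + t * a) • (s • v + t • u) -
          t • ((s * a - t * b) • v + (s * b + t * a) • u) := by module
        rw [e, h1, hst]
        simp
      have h3 : s ^ 2 + t ^ 2 = 0 :=
        (mul_eq_zero.1 ((smul_eq_zero.1 h2).resolve_right hv)).resolve_left hb
      constructor <;> nlinarith [sq_nonneg s, sq_nonneg t]
    obtain ⟨hU, hU'⟩ := exists_invariant_hasRowBound_of_linearIndependent (S := S)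
      (w := ![v, u]) (M := ![![a, b], ![-b, a]]) (c := a + |b|) hli
      (by intro i; fin_cases i <;> simp [hSv, hSu])
      (by intro i; fin_cases i <;> (simp [rowLogNorm]; try linarith))
    refine ⟨_, ?_, hU, hU'⟩
    intro h0
    exact hv ((Submodule.eq_bot_iff _).1 h0 v (Submodule.subset_span ⟨0, rfl⟩))

end RowBound

/-! ### Good bases by induction on the dimension -/

/-- If all eigenvalues `a + b i` satisfy `a + |b| < 0`, some basis makes the logarithmic maximum
norm negative. -/
theorem exists_neg_hasRowBound {V : Type*} [AddCommGroup V] [Module ℝ V] [FiniteDimensional ℝ V]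
    (S : Module.End ℝ V)
    (hS : ∀ a b : ℝ, 0 ≤ a + |b| → ∀ v, Polynomial.aeval S (realFactor a b) v = 0 → v = 0) :
    ∃ c < 0, HasRowBound S c := by
  induction hn : Module.finrank ℝ V using Nat.strong_induction_on generalizing V with
  | _ n ih =>
  rcases subsingleton_or_nontrivial V with hV | hV
  · exact ⟨-1, by norm_num, .of_subsingleton S _⟩
  obtain ⟨a, b, v, hv, hav⟩ := exists_realFactor_apply_eq_zero S
  have hab : a + |b| < 0 := by
    by_contra! h
    exact hv (hS a b h v hav)
  obtain ⟨U, hU0, hU, hUb⟩ := exists_invariant_hasRowBound_of_realFactor hv hav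
  have hlt : Module.finrank ℝ (V ⧸ U) < n := by
    have h1 := U.finrank_quotient_add_finrank
    have h2 := (Submodule.one_le_finrank_iff (S := U)).2 hU0
    omega
  obtain ⟨c, hc, hcQ⟩ := ih _ hlt (U.mapQ U S hU) (by
    intro a b hab
    -- Injectivity need not descend to a quotient, but surjectivity does, and in finite dimension
    -- the two agree.
    rw [← LinearMap.ker_eq_bot', LinearMap.ker_eq_bot_iff_range_eq_top, LinearMap.range_eq_top]
    intro w
    obtain ⟨w, rfl⟩ := U.mkQ_surjective w
    have hsurj : Function.Surjective (Polynomial.aeval S (realFactor a b)) := by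
      rw [← LinearMap.range_eq_top, ← LinearMap.ker_eq_bot_iff_range_eq_top,
        LinearMap.ker_eq_bot']
      exact hS a b hab
    obtain ⟨w, rfl⟩ := hsurj w
    exact ⟨U.mkQ w, aeval_mapQ_mk S U hU _ w⟩) rfl
  -- Since `c < 0`, the value `c / 2` is still negative and leaves slack above `c`.
  refine ⟨max (a + |b|) (c / 2), max_lt hab (by linarith), .of_quotient hU
    (lt_of_lt_of_le (by linarith) (le_max_right _ _)) ?_ hcQ⟩
  obtain ⟨ι, hι, e, M, he, hM⟩ := hUb
  exact ⟨ι, hι, e, M, he, fun i => (hM i).trans (le_max_left _ _)⟩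

/-- If all eigenvalues `a + b i` satisfy `a + |b| ≤ 0`, and those with `a + |b| = 0` are
semisimple, then some basis makes the logarithmic maximum norm nonpositive. -/
theorem hasRowBound_zero {V : Type*} [AddCommGroup V] [Module ℝ V] [FiniteDimensional ℝ V]
    (S : Module.End ℝ V)
    (hS : ∀ a b : ℝ, 0 < a + |b| → ∀ v, Polynomial.aeval S (realFactor a b) v = 0 → v = 0)
    (hS' : ∀ a b : ℝ, a + |b| = 0 → ∀ v, Polynomial.aeval S (realFactor a b)
      (Polynomial.aeval S (realFactor a b) v) = 0 → Polynomial.aeval S (realFactor a b) v = 0) :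
    HasRowBound S 0 := by
  induction hn : Module.finrank ℝ V using Nat.strong_induction_on generalizing V with
  | _ n ih =>
  have ih' : ∀ (U : Submodule ℝ V) (hU : U ≤ U.comap S), U ≠ ⊤ →
      HasRowBound (S.restrict hU) 0 := by
    intro U hU hUt
    refine ih _ (hn ▸ Submodule.finrank_lt hUt) _ ?_ ?_ rfl
    · intro a b hab v hv
      refine Subtype.ext (hS a b hab v ?_)
      rw [← aeval_restrict_coe S U hU, hv]
      rfl
    · intro a b hab v hv
      refine Subtype.ext ?_
      rw [aeval_restrict_coe]
      refine hS' a b hab v ?_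
      rw [← aeval_restrict_coe S U hU, ← aeval_restrict_coe S U hU, hv]
      rfl
  by_cases hcrit : ∃ a b : ℝ, a + |b| = 0 ∧
      ∃ v, v ≠ 0 ∧ Polynomial.aeval S (realFactor a b) v = 0
  · obtain ⟨a, b, hab, v, hv, hav⟩ := hcrit
    set Q := Polynomial.aeval S (realFactor a b) with hQ
    have hcomm : ∀ x, Q (S x) = S (Q x) := fun x => by
      have h1 := Polynomial.aeval_X (R := ℝ) S
      rw [← Module.End.mul_apply, ← Module.End.mul_apply, hQ]
      nth_rw 2 [← h1]
      nth_rw 3 [← h1]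
      rw [← map_mul, ← map_mul, mul_comm]
    -- If `Q = 0`, separability of the factor makes `S` semisimple, so the block has an invariant
    -- complement. Otherwise `ker Q` and `range Q` are proper complementary invariant subspaces.
    by_cases hQ0 : Q = 0
    · obtain ⟨U, hU0, hU, hUb⟩ := exists_invariant_hasRowBound_of_realFactor hv hav
      obtain ⟨W, hW, hUW⟩ := Module.End.isSemisimple_iff.1
        (Module.End.isSemisimple_of_squarefree_aeval_eq_zero
          (realFactor_separable a b).squarefree hQ0) U hU
      rw [hab] at hUb
      refine .of_isCompl hUW hU hUb (hW := hW) (ih' W hW ?_)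
      rintro rfl
      exact hU0 (by simpa using hUW.inf_eq_bot)
    · have hcompl : IsCompl (LinearMap.ker Q) (LinearMap.range Q) := by
        rw [Submodule.isCompl_iff_disjoint]
        · rw [Submodule.disjoint_def]
          rintro _ hx ⟨y, rfl⟩
          exact hS' a b hab y hx
        · rw [add_comm, Q.finrank_range_add_finrank_ker]
      refine .of_isCompl hcompl (hU := fun x hx => ?_) (hW := ?_)
        (ih' _ (fun x hx => ?_) fun h => ?_) (ih' _ ?_ fun h => ?_)
      · rw [LinearMap.mem_ker] at hx ⊢
        rw [hcomm, hx, map_zero]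
      · rintro _ ⟨y, rfl⟩
        exact ⟨S y, hcomm y⟩
      · rw [Submodule.mem_comap, LinearMap.mem_ker]
        rw [hcomm, LinearMap.mem_ker.1 hx, map_zero]
      · exact hQ0 (LinearMap.ker_eq_top.1 h)
      · rintro _ ⟨y, rfl⟩
        exact ⟨S y, hcomm y⟩
      · rw [← LinearMap.ker_eq_bot_iff_range_eq_top, LinearMap.ker_eq_bot'] at h
        exact hv (h v hav)
  · push Not at hcrit
    obtain ⟨c, hc, ι, hι, e, M, he, hM⟩ := exists_neg_hasRowBound S (by
      intro a b hab v hv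
      by_contra hv0
      rcases hab.eq_or_lt with h | h
      · exact hcrit a b h.symm v hv0 hv
      · exact hv0 (hS a b h v hv))
    exact ⟨ι, hι, e, M, he, fun i => (hM i).trans hc.le⟩

/-! ### Multiplicities, transposition and the complex eigenvalue conditions -/

theorem isMatrixEigenvalue_iff_geom_pos {K : Type*} [Field K] {n : ℕ}
    (A : Matrix (Fin n) (Fin n) K) (l : K) : IsMatrixEigenvalue A l ↔ 0 < geom A l := by
  rw [IsMatrixEigenvalue, geom, Module.End.hasEigenvalue_iff, ← Submodule.one_le_finrank_iff]
  rfl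

theorem geom_add_rank {K : Type*} [Field K] {n : ℕ} (A : Matrix (Fin n) (Fin n) K) (l : K) :
    geom A l + (A - Matrix.scalar (Fin n) l).rank = n := by
  have h := (Matrix.toLin' (A - Matrix.scalar (Fin n) l)).finrank_range_add_finrank_ker
  rw [Module.finrank_fin_fun] at h
  have h2 : Module.End.eigenspace (Matrix.toLin' A) l =
      LinearMap.ker (Matrix.toLin' (A - Matrix.scalar (Fin n) l)) := by
    ext v
    simp [sub_eq_zero]
  rw [geom, h2, add_comm]
  exact h

theorem geom_transpose {K : Type*} [Field K] {n : ℕ} (A : Matrix (Fin n) (Fin n) K) (l : K) :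
    geom A.transpose l = geom A l := by
  have h1 := geom_add_rank A l
  have h2 := geom_add_rank A.transpose l
  rw [← Matrix.rank_transpose] at h1
  simp only [Matrix.transpose_sub, Matrix.scalar_apply, Matrix.diagonal_transpose] at h1 h2
  omega

theorem algm_transpose {K : Type*} [Field K] {n : ℕ} (A : Matrix (Fin n) (Fin n) K) (l : K) :
    algm A.transpose l = algm A l := by
  rw [algm, algm, Matrix.charpoly_transpose]

theorem isMatrixEigenvalue_transpose_iff {K : Type*} [Field K] {n : ℕ}
    (A : Matrix (Fin n) (Fin n) K) (l : K) :
    IsMatrixEigenvalue A.transpose l ↔ IsMatrixEigenvalue A l := by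
  rw [isMatrixEigenvalue_iff_geom_pos, isMatrixEigenvalue_iff_geom_pos, geom_transpose]

/-- An eigenvalue of full geometric multiplicity has no generalized eigenvectors of rank two. -/
theorem sub_apply_eq_zero_of_algm_le_geom {K : Type*} [Field K] {n : ℕ}
    (A : Matrix (Fin n) (Fin n) K) (l : K)
    (h : IsMatrixEigenvalue A l → algm A l ≤ geom A l) (v : Fin n → K)
    (hv : (A - Matrix.scalar (Fin n) l).mulVec ((A - Matrix.scalar (Fin n) l).mulVec v) = 0) :
    (A - Matrix.scalar (Fin n) l).mulVec v = 0 := by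
  set f : Module.End K (Fin n → K) := Matrix.toLin' A with hf
  have happ : ∀ w, (A - Matrix.scalar (Fin n) l).mulVec w = (f - algebraMap K _ l) w := by
    intro w
    simp [hf, Matrix.sub_mulVec]
  simp only [happ] at hv ⊢
  by_cases hl : IsMatrixEigenvalue A l
  -- The maximal generalized eigenspace has dimension `algm A l`, so the eigenspace fills it.
  · have heq : f.eigenspace l = f.maxGenEigenspace l := by
      refine Submodule.eq_of_le_of_finrank_le (f.genEigenspace_le_maximal l 1) ?_
      rw [LinearMap.finrank_maxGenEigenspace_eq, hf, Matrix.charpoly_toLin']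
      exact h hl
    have hmem : v ∈ f.maxGenEigenspace l := by
      rw [Module.End.mem_maxGenEigenspace]
      refine ⟨2, ?_⟩
      rw [pow_two, Module.End.mul_apply]
      exact hv
    rw [← heq, Module.End.mem_eigenspace_iff] at hmem
    simp [hmem]
  · have h0 : f.eigenspace l = ⊥ := by
      by_contra hne
      exact hl (Module.End.hasEigenvalue_iff.2 hne)
    have hinj : ∀ w, (f - algebraMap K _ l) w = 0 → w = 0 := by
      intro w hw
      have : w ∈ f.eigenspace l := by
        rw [Module.End.mem_eigenspace_iff]
        simpa [sub_eq_zero] using hw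
      simpa [h0] using this
    exact hinj _ hv

theorem isMatrixEigenvalue_of_sub_apply_eq_zero {K : Type*} [Field K] {n : ℕ}
    {A : Matrix (Fin n) (Fin n) K} {l : K} {v : Fin n → K} (hv : v ≠ 0)
    (h : (A - Matrix.scalar (Fin n) l).mulVec v = 0) : IsMatrixEigenvalue A l := by
  refine Module.End.hasEigenvalue_of_hasEigenvector (x := v) ⟨?_, hv⟩
  rw [Module.End.mem_eigenspace_iff]
  simpa [Matrix.sub_mulVec, sub_eq_zero] using h

theorem aeval_realFactor_zero_apply {n : ℕ} (A : Matrix (Fin n) (Fin n) ℝ) (a : ℝ)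
    (v : Fin n → ℝ) :
    Polynomial.aeval (Matrix.toLin' A) (realFactor a 0) v =
      (A - Matrix.scalar (Fin n) a).mulVec v := by
  simp [realFactor, Matrix.sub_mulVec]

theorem complexify_mulVec_ofReal {n : ℕ} (A : Matrix (Fin n) (Fin n) ℝ) (v : Fin n → ℝ) :
    (complexify A).mulVec (fun i => (v i : ℂ)) = fun i => ((A.mulVec v i : ℝ) : ℂ) := by
  ext i
  simp [complexify, Matrix.mulVec, dotProduct]

/-- Over `ℂ` the quadratic splits as the product over `z` and its conjugate, which links the real
factors to complex eigenvalues. -/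
theorem aeval_realFactor_apply_ofReal {n : ℕ} (A : Matrix (Fin n) (Fin n) ℝ) {a b : ℝ}
    (hb : b ≠ 0) (v : Fin n → ℝ) :
    (fun i => ((Polynomial.aeval (Matrix.toLin' A) (realFactor a b) v i : ℝ) : ℂ)) =
      (complexify A - Matrix.scalar (Fin n) (⟨a, b⟩ : ℂ)).mulVec
        ((complexify A - Matrix.scalar (Fin n) (⟨a, -b⟩ : ℂ)).mulVec (fun i => (v i : ℂ))) := by
  have h1 : (⟨a, b⟩ : ℂ) = a + b * Complex.I := Complex.mk_eq_add_mul_I a b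
  have h2 : (⟨a, -b⟩ : ℂ) = a - b * Complex.I := by
    rw [Complex.mk_eq_add_mul_I]
    push_cast
    ring
  have hs : ∀ (z : ℂ) (w : Fin n → ℂ), (Matrix.scalar (Fin n) z).mulVec w = z • w := by
    intro z w
    simp
  have h3 : (complexify A).mulVec ((complexify A).mulVec (fun i => (v i : ℂ))) =
      fun i => ((A.mulVec (A.mulVec v) i : ℝ) : ℂ) := by
    rw [complexify_mulVec_ofReal, complexify_mulVec_ofReal]
  simp only [Matrix.sub_mulVec, hs, Matrix.mulVec_sub, Matrix.mulVec_smul, h3]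
  ext i
  simp only [complexify_mulVec_ofReal, h1, h2, Pi.sub_apply, Pi.smul_apply, smul_eq_mul]
  simp only [realFactor, if_neg hb, pow_two, map_add, map_mul, map_sub, Polynomial.aeval_X,
    Polynomial.aeval_C, LinearMap.add_apply, Module.End.mul_apply, LinearMap.sub_apply,
    Module.algebraMap_end_apply, smul_sub, map_smul, Pi.sub_apply, Pi.smul_apply, smul_eq_mul,
    Pi.add_apply, Matrix.toLin'_apply, Complex.ofReal_add, Complex.ofReal_sub, Complex.ofReal_mul]
  linear_combination ((b : ℂ) * b * v i) * Complex.I_mul_I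

/-- A matrix satisfying the eigenvalue conditions has, in suitable coordinates of the source,
nonpositive logarithmic maximum norm. -/
theorem hasRowBound_zero_toLin' {n : ℕ} (A : Matrix (Fin n) (Fin n) ℝ)
    (ha : ∀ l : ℝ, IsMatrixEigenvalue A l → l ≤ 0)
    (hb : ∀ l : ℝ, IsMatrixEigenvalue A l → geom A l < algm A l → l < 0)
    (hc : ∀ z : ℂ, z.im ≠ 0 → IsMatrixEigenvalue (complexify A) z → z.re + |z.im| ≤ 0)
    (hd : ∀ z : ℂ, z.im ≠ 0 → IsMatrixEigenvalue (complexify A) z →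
      geom (complexify A) z < algm (complexify A) z → z.re + |z.im| < 0) :
    HasRowBound (Matrix.toLin' A) 0 := by
  have hofReal : ∀ w : Fin n → ℝ, (fun i => ((w i : ℝ) : ℂ)) = 0 ↔ w = 0 := by
    intro w
    simp [funext_iff]
  refine hasRowBound_zero _ ?_ ?_
  · intro a b hab v hv
    by_contra hv0
    by_cases hb0 : b = 0
    · subst hb0
      rw [aeval_realFactor_zero_apply] at hv
      have := ha a (isMatrixEigenvalue_of_sub_apply_eq_zero hv0 hv)
      simp only [abs_zero, add_zero] at hab
      linarith
    · rw [← hofReal, aeval_realFactor_apply_ofReal A hb0] at hv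
      -- Either `v` is an eigenvector for the conjugate, or its image is one for `a + b i`.
      by_cases hw : (complexify A - Matrix.scalar (Fin n) (⟨a, -b⟩ : ℂ)).mulVec
          (fun i => (v i : ℂ)) = 0
      · have := hc ⟨a, -b⟩ (by simpa using hb0)
          (isMatrixEigenvalue_of_sub_apply_eq_zero (fun h => hv0 ((hofReal v).1 h)) hw)
        simp only [abs_neg] at this
        linarith
      · have := hc ⟨a, b⟩ hb0 (isMatrixEigenvalue_of_sub_apply_eq_zero hw hv)
        simp only at this
        linarith
  · intro a b hab v hv
    by_cases hb0 : b = 0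
    · subst hb0
      simp only [aeval_realFactor_zero_apply] at hv ⊢
      refine sub_apply_eq_zero_of_algm_le_geom A a (fun hl => ?_) v hv
      by_contra! hlt
      have := hb a hl hlt
      simp only [abs_zero, add_zero] at hab
      linarith
    · rw [← hofReal, aeval_realFactor_apply_ofReal A hb0,
        aeval_realFactor_apply_ofReal A hb0] at hv
      rw [← hofReal, aeval_realFactor_apply_ofReal A hb0]
      have key : ∀ z : ℂ, z.im ≠ 0 → z.re + |z.im| = 0 →
          IsMatrixEigenvalue (complexify A) z → algm (complexify A) z ≤ geom (complexify A) z := by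
        intro z hz hz' hl
        by_contra! hlt
        have := hd z hz hl hlt
        linarith
      have key1 := sub_apply_eq_zero_of_algm_le_geom _ _ (key ⟨a, b⟩ hb0 hab)
      have key2 := sub_apply_eq_zero_of_algm_le_geom _ _
        (key ⟨a, -b⟩ (by simpa using hb0) (by simpa using hab))
      set P := complexify A - Matrix.scalar (Fin n) (⟨a, b⟩ : ℂ) with hP
      set R := complexify A - Matrix.scalar (Fin n) (⟨a, -b⟩ : ℂ) with hR
      have hPR : ∀ w, R.mulVec (P.mulVec w) = P.mulVec (R.mulVec w) := by
        intro w
        rw [Matrix.mulVec_mulVec, Matrix.mulVec_mulVec]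
        congr 1
        exact ((Commute.refl _).sub_right (Matrix.scalar_commute _ (Commute.all _) _).symm).sub_left
          (Matrix.scalar_commute _ (Commute.all _) _)
      -- As `P` and `R` commute, `hv` says `P P R R v = 0`; `key1` removes one `P`, then `key2` one
      -- `R`.
      rw [hPR] at hv
      have h1 := key1 _ hv
      rw [← hPR, ← hPR] at h1
      have h2 := key2 _ h1
      rwa [hPR] at h2

/-! ### From the row bound to invariance -/

/-- If `F A = M F` where `M` has nonpositive logarithmic maximum norm, then `‖F x‖ ≤ 1` is
invariant under `dx/dt = A x`. -/
theorem isLinearInvariant_of_rowLogNorm_nonpos {n s : ℕ} {A : Matrix (Fin n) (Fin n) ℝ}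
    {F : Matrix (Fin s) (Fin n) ℝ} {M : Matrix (Fin s) (Fin s) ℝ} (h : F * A = M * F)
    (hM : ∀ i, rowLogNorm M i ≤ 0) : IsLinearInvariant A F := by
  intro x hx h0 t ht
  -- The shift by `k` makes the diagonal of `M + k` nonnegative, so its row sums of absolute values
  -- are at most `k`.
  set k : ℝ := ∑ i, |M i i| with hk
  have hbound : ∀ y : Fin s → ℝ, ‖M.mulVec y + k • y‖ ≤ k * ‖y‖ := by
    intro y
    have hk0 : 0 ≤ k := by positivity
    rw [pi_norm_le_iff_of_nonneg (by positivity)]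
    intro i
    have hki : |M i i| ≤ k :=
      Finset.single_le_sum (f := fun i => |M i i|) (fun _ _ => abs_nonneg _) (Finset.mem_univ i)
    have hrow : M i i - |M i i| + ∑ j, |M i j| ≤ 0 := hM i
    rw [← Finset.add_sum_erase _ _ (Finset.mem_univ i)] at hrow
    have hsum : (M.mulVec y + k • y) i =
        (M i i + k) * y i + ∑ j ∈ Finset.univ.erase i, M i j * y j := by
      rw [Pi.add_apply, Matrix.mulVec, dotProduct, ← Finset.add_sum_erase _ _ (Finset.mem_univ i)]
      simp only [Pi.smul_apply, smul_eq_mul]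
      ring
    have hy : ∀ j, |y j| ≤ ‖y‖ := fun j => norm_le_pi_norm y j
    have hpos : 0 ≤ M i i + k := by linarith [neg_abs_le (M i i)]
    calc ‖(M.mulVec y + k • y) i‖
        ≤ |(M i i + k) * y i| + |∑ j ∈ Finset.univ.erase i, M i j * y j| := by
          rw [hsum]
          exact abs_add_le _ _
      _ ≤ (M i i + k) * ‖y‖ + ∑ j ∈ Finset.univ.erase i, |M i j| * ‖y‖ := by
          refine add_le_add ?_ ((Finset.abs_sum_le_sum_abs _ _).trans
            (Finset.sum_le_sum fun j _ => ?_))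
          · rw [abs_mul, abs_of_nonneg hpos]
            exact mul_le_mul_of_nonneg_left (hy i) hpos
          · rw [abs_mul]
            exact mul_le_mul_of_nonneg_left (hy j) (abs_nonneg _)
      _ = (M i i + ∑ j ∈ Finset.univ.erase i, |M i j|) * ‖y‖ + k * ‖y‖ := by
          rw [← Finset.sum_mul]
          ring
      _ ≤ k * ‖y‖ := by
          have := mul_nonpos_of_nonpos_of_nonneg
            (show M i i + ∑ j ∈ Finset.univ.erase i, |M i j| ≤ 0 by linarith) (norm_nonneg y)
          linarith
  -- Here `z' = (M + k) z`, so Grönwall gives `‖z t‖ ≤ exp (k t)`, and the exponential cancels.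
  set z : ℝ → Fin s → ℝ := fun τ => Real.exp (k * τ) • F.mulVec (x τ) with hz
  have hFx : ∀ τ, 0 ≤ τ →
      HasDerivWithinAt (fun τ => F.mulVec (x τ)) (M.mulVec (F.mulVec (x τ))) (Set.Ici 0) τ := by
    intro τ hτ
    have h1 := (LinearMap.toContinuousLinearMap F.mulVecLin).hasFDerivAt.comp_hasDerivWithinAt τ
      (hx τ hτ)
    have h2 : M.mulVec (F.mulVec (x τ)) = F.mulVec (A.mulVec (x τ)) := by
      rw [Matrix.mulVec_mulVec, Matrix.mulVec_mulVec, h]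
    rw [h2]
    exact h1
  have hzd : ∀ τ, 0 ≤ τ → HasDerivWithinAt z
      (Real.exp (k * τ) • (M.mulVec (F.mulVec (x τ)) + k • F.mulVec (x τ))) (Set.Ici 0) τ := by
    intro τ hτ
    have he : HasDerivWithinAt (fun τ => Real.exp (k * τ)) (Real.exp (k * τ) * (k * 1))
        (Set.Ici 0) τ := (((hasDerivAt_id τ).const_mul k).exp).hasDerivWithinAt
    refine (he.smul (hFx τ hτ)).congr_deriv ?_
    module
  have hle := norm_le_gronwallBound_of_norm_deriv_right_le (f := z) (δ := 1) (K := k) (ε := 0)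
    (a := 0) (b := t)
    (fun τ hτ => ((hzd τ hτ.1).continuousWithinAt).mono Set.Icc_subset_Ici_self)
    (fun τ hτ => (hzd τ hτ.1).mono (Set.Ici_subset_Ici.2 hτ.1))
    (by simpa [hz] using (show ‖F.mulVec (x 0)‖ ≤ 1 from h0))
    (fun τ _ => by
      rw [add_zero, norm_smul, hz, norm_smul, mul_left_comm]
      exact mul_le_mul_of_nonneg_left (hbound _) (norm_nonneg _))
    t ⟨ht, le_rfl⟩
  rw [gronwallBound_ε0, sub_zero, one_mul, hz, norm_smul, Real.norm_eq_abs, Real.abs_exp] at hle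
  exact le_of_mul_le_mul_left (hle.trans_eq (mul_one _).symm) (Real.exp_pos _)

theorem theorem1 (n : ℕ) (A : Matrix (Fin n) (Fin n) ℝ)
    (ha : ∀ l : ℝ, IsMatrixEigenvalue A l → l ≤ 0)
    (hb : ∀ l : ℝ, IsMatrixEigenvalue A l → geom A l < algm A l → l < 0)
    (hc : ∀ z : ℂ, z.im ≠ 0 → IsMatrixEigenvalue (complexify A) z → z.re + |z.im| ≤ 0)
    (hd : ∀ z : ℂ, z.im ≠ 0 → IsMatrixEigenvalue (complexify A) z →
      geom (complexify A) z < algm (complexify A) z → z.re + |z.im| < 0) :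
    ∃ F : Matrix (Fin n) (Fin n) ℝ, IsUnit F.det ∧ IsLinearInvariant A F := by
  have hcT : complexify A.transpose = (complexify A).transpose := rfl
  obtain ⟨ι, _, b, M, hM, hMle⟩ := hasRowBound_zero_toLin' A.transpose
    (by simpa only [isMatrixEigenvalue_transpose_iff] using ha)
    (by simpa only [isMatrixEigenvalue_transpose_iff, geom_transpose, algm_transpose] using hb)
    (by simpa only [hcT, isMatrixEigenvalue_transpose_iff] using hc)
    (by simpa only [hcT, isMatrixEigenvalue_transpose_iff, geom_transpose, algm_transpose]
      using hd)
  have hcard : Fintype.card ι = Fintype.card (Fin n) := by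
    rw [← Module.finrank_eq_card_basis b, Module.finrank_fintype_fun_eq_card]
  let e : Fin n ≃ ι := (Fintype.equivOfCardEq hcard).symm
  -- Basis vectors for the transpose become the rows of `F`; transposing their relations gives `F *
  -- A = M * F`.
  let F : Matrix (Fin n) (Fin n) ℝ := Matrix.of fun i => b (e i)
  refine ⟨F, ?_, isLinearInvariant_of_rowLogNorm_nonpos
    (M := Matrix.of fun i j => M (e i) (e j)) ?_ ?_⟩
  · rw [← Matrix.isUnit_iff_isUnit_det, ← Matrix.linearIndependent_rows_iff_isUnit]
    exact b.linearIndependent.comp e e.injective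
  · ext i l
    have h1 := congrFun (hM (e i)) l
    rw [← e.sum_comp] at h1
    simp only [Matrix.toLin'_apply, Matrix.mulVec, dotProduct, Matrix.transpose_apply,
      Finset.sum_apply, Pi.smul_apply, smul_eq_mul] at h1
    simp only [F, Matrix.mul_apply, Matrix.of_apply, ← h1, mul_comm]
  · intro i
    have h1 := hMle (e i)
    rw [rowLogNorm, ← e.sum_comp] at h1
    exact h1
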